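/- Let $r\ge 0$ be an integer and let $G=(V,E)$ be a finite simple undirected graph. A nonempty set $S\subseteq V$ is called $r$-reachable if some vertex $i\in S$ has at least $r$ neighbours in $V\setminus S$. The graph $G$ is called $r$-robust if for any two disjoint nonempty sets $S_1,S_2\subseteq V$ at least one of $S_1,S_2$ is $r$-reachable. Suppose that $G$ is $r$-robust and, in case $r\ge 2$, that $|V|\ge 2$ (graphs with at most one vertex satisfy the definition vacuously for every $r$). Then, whatever the number of vertices of $G$, $$|E|\ \ge\ \frac{3r(r-1)}{2}.$$ -/

import Mathlib

/-- A set `S` of vertices of a finite simple graph `G` is `r`-reachable if some vertex of `S` has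
at least `r` neighbours outside `S`. (Such a set is automatically nonempty.) -/
def IsReachableSet {V : Type*} [Fintype V] [DecidableEq V] (G : SimpleGraph V)
    [DecidableRel G.Adj] (r : ℕ) (S : Finset V) : Prop :=
  ∃ i ∈ S, r ≤ (G.neighborFinset i \ S).card

/-- A finite simple graph is `r`-robust if, of any two disjoint nonempty sets of vertices, at least
one is `r`-reachable. -/
def IsRobust {V : Type*} [Fintype V] [DecidableEq V] (G : SimpleGraph V)
    [DecidableRel G.Adj] (r : ℕ) : Prop :=
  ∀ S₁ S₂ : Finset V, S₁.Nonempty → S₂.Nonempty → Disjoint S₁ S₂ →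
    IsReachableSet G r S₁ ∨ IsReachableSet G r S₂

/-! Let `r ≥ 2`. A set with fewer than `r` vertices outside it is never reachable, so every nonempty
set of at most `r - 1` vertices is. Among sets missing exactly `r - 1` vertices, let `B` span the
most edges. Peeling reachable vertices off `Bᶜ` accounts for `r * (r - 1)` edges not inside `B`.
Some `a ∉ B` has `r` neighbours in `B`, so by maximality under swaps `B` has inner minimum degree at
least `r - 1`; as `r ≤ B.card`, it spans at least `r * (r - 1) / 2` more. -/

section RobustEdgeBound

variable {V : Type*} [Fintype V] [DecidableEq V] (G : SimpleGraph V) [DecidableRel G.Adj]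

/-- The edges of `G` with both ends in `B`. -/
def edgesWithin (B : Finset V) : Finset (Sym2 V) :=
  G.edgeFinset.filter fun e => ∀ v ∈ e, v ∈ B

variable {G}

lemma mk_mem_edgesWithin {B : Finset V} {x y : V} :
    s(x, y) ∈ edgesWithin G B ↔ G.Adj x y ∧ x ∈ B ∧ y ∈ B := by
  simp [edgesWithin]

lemma edgesWithin_insert {C : Finset V} (a : V) :
    edgesWithin G (insert a C) =
      edgesWithin G C ∪ (G.neighborFinset a ∩ C).image (fun w => s(a, w)) := by
  ext e
  induction e using Sym2.ind with
  | _ x y =>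
    have := G.irrefl (v := a)
    have := G.adj_comm x y
    simp only [Finset.mem_union, mk_mem_edgesWithin, Finset.mem_insert, Finset.mem_image,
      Finset.mem_inter, SimpleGraph.mem_neighborFinset, Sym2.eq_iff]
    grind

lemma card_edgesWithin_insert {C : Finset V} {a : V} (ha : a ∉ C) :
    (edgesWithin G (insert a C)).card =
      (edgesWithin G C).card + (G.neighborFinset a ∩ C).card := by
  rw [edgesWithin_insert, Finset.card_union_of_disjoint, Finset.card_image_of_injective]
  · intro x y h
    exact Sym2.congr_right.1 h
  · rw [Finset.disjoint_right]
    intro e he h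
    obtain ⟨w, -, rfl⟩ := Finset.mem_image.1 he
    exact ha (mk_mem_edgesWithin.1 h).2.1

/-- A lower bound on the minimum degree inside `B` gives one on the number of edges inside `B`. -/
lemma card_mul_le_two_mul_card_edgesWithin {B : Finset V} {m : ℕ}
    (h : ∀ b ∈ B, m ≤ (G.neighborFinset b ∩ B).card) :
    B.card * m ≤ (edgesWithin G B).card * 2 := by
  refine Finset.card_mul_le_card_mul (fun b e => b ∈ e) (fun b hb => (h b hb).trans ?_) ?_
  · refine Finset.card_le_card_of_injOn (fun w => s(b, w)) (fun w hw => ?_) ?_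
    · simp only [Finset.coe_inter, Set.mem_inter_iff, Finset.mem_coe,
        SimpleGraph.mem_neighborFinset] at hw
      simp [Finset.bipartiteAbove, mk_mem_edgesWithin, hw, hb]
    · intro x _ y _ hxy
      exact Sym2.congr_right.1 hxy
  · intro e _
    induction e using Sym2.ind with
    | _ x y =>
      refine (Finset.card_le_card (t := {x, y}) fun z hz => ?_).trans Finset.card_le_two
      simpa using (Finset.mem_filter.1 hz).2

lemma not_isReachableSet_of_card_compl_lt {r : ℕ} {S : Finset V} (h : Sᶜ.card < r) :
    ¬ IsReachableSet G r S := by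
  rintro ⟨i, -, hi⟩
  refine absurd (hi.trans (Finset.card_le_card (t := Sᶜ) fun x hx => ?_)) (by omega)
  simpa using (Finset.mem_sdiff.1 hx).2

/-- An `r`-robust graph with at least two vertices has at least `2 * r - 1` vertices. -/
lemma IsRobust.two_mul_le_card {r : ℕ} (hG : IsRobust G r) (hr : 2 ≤ r)
    (hV : 2 ≤ Fintype.card V) : 2 * r ≤ Fintype.card V + 1 := by
  by_contra! hlt
  -- With at most `2 * r - 2` vertices, both halves have fewer than `r`, so neither is reachable.
  obtain ⟨S, -, hS⟩ := Finset.exists_subset_card_eq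
    (s := (Finset.univ : Finset V)) (n := Fintype.card V / 2) (by rw [Finset.card_univ]; omega)
  have hc := Finset.card_compl S
  rcases hG S Sᶜ (Finset.card_pos.1 (by omega)) (Finset.card_pos.1 (by omega))
    disjoint_compl_right with h | h
  · exact not_isReachableSet_of_card_compl_lt (by omega) h
  · exact not_isReachableSet_of_card_compl_lt (by rw [compl_compl]; omega) h

/-- In an `r`-robust graph, every nonempty set of fewer than `r` vertices is `r`-reachable. -/
lemma IsRobust.isReachableSet_of_card_lt {r : ℕ} (hG : IsRobust G r) {S : Finset V}
    (hS : S.Nonempty) (hSr : S.card < r) (hV : S.card < Fintype.card V) :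
    IsReachableSet G r S := by
  have hc := Finset.card_compl S
  refine (hG S Sᶜ hS (Finset.card_pos.1 (by omega)) disjoint_compl_right).resolve_right ?_
  exact not_isReachableSet_of_card_compl_lt (by rwa [compl_compl])

/-- If every nonempty set of at most `k` vertices is `r`-reachable, then a set `S` of at most `k`
vertices meets at least `r * S.card` edges. -/
lemma card_edgesWithin_compl_add_le {r k : ℕ}
    (h : ∀ S : Finset V, S.Nonempty → S.card ≤ k → IsReachableSet G r S) (S : Finset V)
    (hS : S.card ≤ k) :
    (edgesWithin G Sᶜ).card + r * S.card ≤ G.edgeFinset.card := by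
  induction S using Finset.strongInduction with
  | H S ih =>
    rcases S.eq_empty_or_nonempty with rfl | hne
    · simp [edgesWithin]
    · obtain ⟨v, hv, hvr⟩ := h S hne hS
      have hcard := Finset.card_erase_add_one hv
      -- Moving `v` into the complement of `S` gains its edges to that complement, at least `r` of
      -- them.
      have key := ih (S.erase v) (Finset.erase_ssubset hv) (by omega)
      rw [Finset.compl_erase, card_edgesWithin_insert (by simpa using hv),
        ← Finset.sdiff_eq_inter_compl] at key
      rw [← hcard, mul_add]
      omega

/-- If `B` has the most inner edges among sets of its size, then a vertex outside `B` with `d + 1`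
neighbours in `B` forces minimum degree at least `d` inside `B`. -/
lemma le_card_neighborFinset_inter_of_maximal {B : Finset V}
    (hmax : ∀ B' : Finset V, B'.card = B.card →
      (edgesWithin G B').card ≤ (edgesWithin G B).card)
    {a : V} (ha : a ∉ B) {d : ℕ} (had : d + 1 ≤ (G.neighborFinset a ∩ B).card)
    {b : V} (hb : b ∈ B) : d ≤ (G.neighborFinset b ∩ B).card := by
  have haC : a ∉ B.erase b := fun h => ha (Finset.mem_of_mem_erase h)
  have h := hmax (insert a (B.erase b)) (by
    rw [Finset.card_insert_of_notMem haC, Finset.card_erase_add_one hb])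
  have hB := card_edgesWithin_insert (G := G) (Finset.notMem_erase b B)
  rw [Finset.insert_erase hb] at hB
  rw [card_edgesWithin_insert haC, hB] at h
  have h₁ : (G.neighborFinset b ∩ B.erase b).card ≤ (G.neighborFinset b ∩ B).card :=
    Finset.card_le_card (Finset.inter_subset_inter_left (Finset.erase_subset b B))
  -- The swap costs `a` at most one neighbour, namely `b`; hence `d + 1` drops to `d`.
  have h₂ := Finset.pred_card_le_card_erase (s := G.neighborFinset a ∩ B) (a := b)
  rw [← Finset.inter_erase] at h₂
  omega

/-- An `r`-robust graph on at least two vertices satisfies `3 * r * (r - 1) ≤ 2 * |E|`. -/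
lemma IsRobust.three_mul_le_two_mul_card_edgeFinset {r : ℕ} (hG : IsRobust G r) (hr : 2 ≤ r)
    (hV : 2 ≤ Fintype.card V) : 3 * (r * (r - 1)) ≤ 2 * G.edgeFinset.card := by
  have hn := hG.two_mul_le_card hr hV
  have hreach : ∀ S : Finset V, S.Nonempty → S.card ≤ r - 1 → IsReachableSet G r S :=
    fun S hS hSr => hG.isReachableSet_of_card_lt hS (by omega) (by omega)
  obtain ⟨B, hB, hmax⟩ := Finset.exists_max_image
    ((Finset.univ : Finset V).powersetCard (Fintype.card V - (r - 1)))
    (fun B => (edgesWithin G B).card)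
    (Finset.powersetCard_nonempty.2 (by rw [Finset.card_univ]; omega))
  replace hB := (Finset.mem_powersetCard.1 hB).2
  have hBc : Bᶜ.card = r - 1 := by rw [Finset.card_compl]; omega
  have hpeel := card_edgesWithin_compl_add_le hreach Bᶜ hBc.le
  rw [compl_compl, hBc] at hpeel
  obtain ⟨a, ha, har⟩ := hreach Bᶜ (Finset.card_pos.1 (by omega)) hBc.le
  rw [Finset.sdiff_eq_inter_compl, compl_compl] at har
  have hdeg := card_mul_le_two_mul_card_edgesWithin (G := G) (B := B) (m := r - 1) fun b hb =>
    le_card_neighborFinset_inter_of_maximal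
      (fun B' hB' => hmax B' (Finset.mem_powersetCard.2 ⟨Finset.subset_univ _, hB'.trans hB⟩))
      (Finset.mem_compl.1 ha) (by omega) hb
  -- `r ≤ B.card` is exactly the bound `hn` of at least `2 * r - 1` vertices.
  have hmul : r * (r - 1) ≤ B.card * (r - 1) := Nat.mul_le_mul_right _ (by omega)
  omega

end RobustEdgeBound

theorem mainTheorem8 {V : Type*} [Fintype V] [DecidableEq V] (G : SimpleGraph V)
    [DecidableRel G.Adj] (r : ℕ) (hV : 2 ≤ r → 2 ≤ Fintype.card V) (hG : IsRobust G r) :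
    3 * (r : ℝ) * ((r : ℝ) - 1) / 2 ≤ (G.edgeFinset.card : ℝ) := by
  rcases lt_or_ge r 2 with hr | hr
  · interval_cases r <;> simp
  · have h := hG.three_mul_le_two_mul_card_edgeFinset hr (hV hr)
    have h' : (3 * (r * ((r - 1 : ℕ) : ℝ))) ≤ 2 * (G.edgeFinset.card : ℝ) := by exact_mod_cast h
    rw [Nat.cast_sub (by omega), Nat.cast_one] at h'
    linarith
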